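/- **The system DIAL.** Terms are the pure $\lambda$-terms $t,u::=x\mid\lambda x.t\mid tu$, up to $\alpha$-equivalence. *Linear formulas* $L,M$ and *formulas* $A,B$ are given, up to $\alpha$-equivalence, by $$L,M::=\alpha\mid\forall\alpha L\mid\mu\alpha L\mid L\multimap M,\qquad A,B::=L\mid\forall\alpha A\mid L\multimap B\mid A\Rightarrow B,$$ where $\mu\alpha L$ may be formed only if $\alpha$ occurs only positively in $L$. In a judgment $\Gamma;\Delta\vdash t:A$, $\Gamma$ is a finite collection of assignments $x:B$ with $B$ a formula, $\Delta$ is a finite collection of assignments $x:L$ with $L$ a linear formula, and all variables in $\Gamma,\Delta$ are distinct. The derivable judgments are generated by the following rules ($L$ always denotes a linear formula): - (ax1) $x:A;\ \vdash x:A$, and (ax2) $;x:L\vdash x:L$; - ($\mu_e$), ($\mu_i$): $\Gamma;\Delta\vdash t:\mu\alpha L$ if and only if $\Gamma;\Delta\vdash t:L[\mu\alpha L/\alpha]$ (one rule for each direction); - ($\forall_i$): from $\Gamma;\Delta\vdash t:A$ with $\alpha$ not free in $\Gamma;\Delta$ infer $\Gamma;\Delta\vdash t:\forall\alpha A$; -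 ($\forall_e$): from $\Gamma;\Delta\vdash t:\forall\alpha A$ infer $\Gamma;\Delta\vdash t:A[L/\alpha]$; - ($\Rightarrow_e$): from $\Gamma_1;\Delta\vdash t:A\Rightarrow B$ and $\Gamma_2;\ \vdash u:A$ infer $\Gamma_1,\Gamma_2;\Delta\vdash tu:B$; - ($\Rightarrow_i$): from $\Gamma,z:A;\Delta\vdash t:B$ infer $\Gamma;\Delta\vdash\lambda z.t:A\Rightarrow B$; - ($\multimap_e$): from $\Gamma_1;\Delta_1\vdash t:L\multimap B$ and $\Gamma_2;\Delta_2\vdash u:L$ infer $\Gamma_1,\Gamma_2;\Delta_1,\Delta_2\vdash tu:B$; - ($\multimap_i$): from $\Gamma;\Delta,z:L\vdash t:B$ infer $\Gamma;\Delta\vdash\lambda z.t:L\multimap B$; - (Contr): from $\Gamma,x:A,y:A;\Delta\vdash t:B$ infer $\Gamma,z:A;\Delta\vdash t[z/x,z/y]:B$; - (Derel): from $\Gamma;\Delta,x:L\vdash t:B$ infer $\Gamma,x:L;\Delta\vdash t:B$; - (Weak): from $\Gamma;\Delta\vdash t:B$ infer $\Gamma,\Gamma';\Delta,\Delta'\vdash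 t:B$. We write $\vdash t:A$ when the judgment with both contexts empty is derivable. **Church words and size.** Let $\mathbf W=\forall\alpha.(\alpha\multimap\alpha)\Rightarrow(\alpha\multimap\alpha)\Rightarrow(\alpha\multimap\alpha)$. The Church word of $w=i_1\cdots i_n\in\{0,1\}^*$ is $\overline w=\lambda f_0.\lambda f_1.\lambda x.f_{i_1}(f_{i_2}(\cdots(f_{i_n}x)\cdots))$, and $|w|=n$. The number $\sharp t$ of applications in a term is given by $\sharp x=0$, $\sharp(tu)=\sharp t+\sharp u+1$, $\sharp(\lambda x.t)=\sharp t$. **Theorem (Size soundness).** Let $L$ be a linear formula and let $t$ be a $\lambda$-term with $\vdash t:\mathbf W\Rightarrow L$. Then there exists a polynomial $P$ such that, for every $w\in\{0,1\}^*$, the term $t\,\overline w$ has a $\beta$-normal form $[\![t\,\overline w]\!]_\beta$, and $$\sharp[\![t\,\overline w]\!]_\beta\le P(|w|).$$ -/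

import Mathlib

namespace DIAL

/-- `bindIdx x` makes the name `x` the innermost bound index `0` and shifts every other name. -/
def bindIdx (x : ℕ) : ℕ → ℕ := fun y => if y = x then 0 else y + 1

/-- Action of a renaming of names below a binder. -/
def upRen (ρ : ℕ → ℕ) : ℕ → ℕ
  | 0 => 0
  | n + 1 => ρ n + 1

/-! ### Pure lambda-terms, up to alpha-equivalence (de Bruijn indices)

Free variables are named by natural numbers: below `k` binders the index `k + x` denotes the
free variable named `x`. -/

/-- Pure lambda-terms. -/
inductive Term : Type where
  | var : ℕ → Term
  | lam : Term → Term
  | app : Term → Term → Term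

/-- Renaming of the free variables. -/
def Term.rename : (ℕ → ℕ) → Term → Term
  | ρ, .var x => .var (ρ x)
  | ρ, .lam t => .lam (t.rename (upRen ρ))
  | ρ, .app t u => .app (t.rename ρ) (u.rename ρ)

/-- Action of a substitution below a binder. -/
def Term.up (σ : ℕ → Term) : ℕ → Term
  | 0 => .var 0
  | n + 1 => (σ n).rename Nat.succ

/-- Simultaneous capture-avoiding substitution. -/
def Term.subst : (ℕ → Term) → Term → Term
  | σ, .var x => σ x
  | σ, .lam t => .lam (t.subst (Term.up σ))
  | σ, .app t u => .app (t.subst σ) (u.subst σ)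

/-- The substitution of `u` for the index `0`, lowering the other indices. -/
def Term.single (u : Term) : ℕ → Term
  | 0 => u
  | n + 1 => .var n

/-- Contraction of the redex `(λ t) u`. -/
def Term.inst (t u : Term) : Term := t.subst (Term.single u)

/-- `λ z. t`, the abstraction of the free variable named `z`. -/
def Term.lamVar (z : ℕ) (t : Term) : Term := .lam (t.rename (bindIdx z))

/-- One step of full beta-reduction. -/
inductive Beta : Term → Term → Prop where
  | redex (t u : Term) : Beta (.app (.lam t) u) (t.inst u)
  | lam {t t' : Term} : Beta t t' → Beta (.lam t) (.lam t')
  | appL {t t' : Term} (u : Term) : Beta t t' → Beta (.app t u) (.app t' u)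
  | appR (t : Term) {u u' : Term} : Beta u u' → Beta (.app t u) (.app t u')

/-- `u` is a beta-normal form of `t`. -/
def IsBetaNF (t u : Term) : Prop :=
  Relation.ReflTransGen Beta t u ∧ ∀ v, ¬ Beta u v

/-- The number of applications in a term. -/
def Term.apps : Term → ℕ
  | .var _ => 0
  | .lam t => t.apps
  | .app t u => t.apps + u.apps + 1

/-! ### Formulas, up to alpha-equivalence -/

/-- Raw formulas; propositional variables are treated like the variables of terms.
The formulas and the linear formulas are singled out by `IsFormula` and `IsLinear`. -/
inductive Fm : Type where
  | var : ℕ → Fm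
  | all : Fm → Fm
  | mu : Fm → Fm
  | lolli : Fm → Fm → Fm
  | imp : Fm → Fm → Fm

/-- Renaming of the free propositional variables. -/
def Fm.rename : (ℕ → ℕ) → Fm → Fm
  | ρ, .var a => .var (ρ a)
  | ρ, .all A => .all (A.rename (upRen ρ))
  | ρ, .mu A => .mu (A.rename (upRen ρ))
  | ρ, .lolli A B => .lolli (A.rename ρ) (B.rename ρ)
  | ρ, .imp A B => .imp (A.rename ρ) (B.rename ρ)

/-- Action of a substitution below a binder. -/
def Fm.up (σ : ℕ → Fm) : ℕ → Fm
  | 0 => .var 0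
  | n + 1 => (σ n).rename Nat.succ

/-- Simultaneous capture-avoiding substitution. -/
def Fm.subst : (ℕ → Fm) → Fm → Fm
  | σ, .var a => σ a
  | σ, .all A => .all (A.subst (Fm.up σ))
  | σ, .mu A => .mu (A.subst (Fm.up σ))
  | σ, .lolli A B => .lolli (A.subst σ) (B.subst σ)
  | σ, .imp A B => .imp (A.subst σ) (B.subst σ)

/-- The substitution of `B` for the index `0`, lowering the other indices. -/
def Fm.single (B : Fm) : ℕ → Fm
  | 0 => B
  | n + 1 => .var n

/-- `A[B/α]` for the body `A` of a binder of `α`. -/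
def Fm.inst (A B : Fm) : Fm := A.subst (Fm.single B)

/-- `∀ α. A`, the quantification of the free propositional variable named `α`. -/
def Fm.allVar (α : ℕ) (A : Fm) : Fm := .all (A.rename (bindIdx α))

/-- `A.Occ b α`: the propositional variable `α` has a free occurrence in `A`, positive if
`b = true` and negative if `b = false`. -/
def Fm.Occ : Fm → Bool → ℕ → Prop
  | .var β, b, α => β = α ∧ b = true
  | .all A, b, α => A.Occ b (α + 1)
  | .mu A, b, α => A.Occ b (α + 1)
  | .lolli A B, b, α => A.Occ (!b) α ∨ B.Occ b α
  | .imp A B, b, α => A.Occ (!b) α ∨ B.Occ b α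

/-- `α` is a free variable of `A`. -/
def Fm.Free (α : ℕ) (A : Fm) : Prop := ∃ b, A.Occ b α

/-- Linear formulas: `L, M ::= α | ∀ α L | μ α L | L ⊸ M`, where `μ α L` requires that `α`
occurs only positively in `L`. -/
def Fm.IsLinear : Fm → Prop
  | .var _ => True
  | .all L => L.IsLinear
  | .mu L => L.IsLinear ∧ ¬ L.Occ false 0
  | .lolli L M => L.IsLinear ∧ M.IsLinear
  | .imp _ _ => False

/-- Formulas: `A, B ::= L | ∀ α A | L ⊸ B | A ⇒ B`. -/
inductive Fm.IsFormula : Fm → Prop where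
  | linear {L : Fm} : L.IsLinear → IsFormula L
  | all {A : Fm} : IsFormula A → IsFormula (.all A)
  | lolli {L B : Fm} : L.IsLinear → IsFormula B → IsFormula (.lolli L B)
  | imp {A B : Fm} : IsFormula A → IsFormula B → IsFormula (.imp A B)

/-! ### The typing system -/

/-- Finite collections of assignments `x : A`; their order is irrelevant. -/
abbrev Ctx : Type := Multiset (ℕ × Fm)

/-- All assignments in `Γ` and `Δ` are for pairwise distinct variables. -/
def Distinct (Γ Δ : Ctx) : Prop := ((Γ + Δ).map Prod.fst).Nodup

/-- `Typed Γ Δ t A` is derivability of the judgment `Γ; Δ ⊢ t : A`. -/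
inductive Typed : Ctx → Ctx → Term → Fm → Prop where
  | ax1 (x : ℕ) {A : Fm} : A.IsFormula → Typed {(x, A)} 0 (.var x) A
  | ax2 (x : ℕ) {L : Fm} : L.IsLinear → Typed 0 {(x, L)} (.var x) L
  | muE {Γ Δ : Ctx} {t : Term} {L : Fm} :
      Typed Γ Δ t (.mu L) → Typed Γ Δ t (L.inst (.mu L))
  | muI {Γ Δ : Ctx} {t : Term} {L : Fm} : (Fm.mu L).IsLinear →
      Typed Γ Δ t (L.inst (.mu L)) → Typed Γ Δ t (.mu L)
  | allI {Γ Δ : Ctx} {t : Term} {A : Fm} (α : ℕ) :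
      Typed Γ Δ t A → (∀ p ∈ Γ + Δ, ¬ Fm.Free α p.2) → Typed Γ Δ t (Fm.allVar α A)
  | allE {Γ Δ : Ctx} {t : Term} {A L : Fm} : L.IsLinear →
      Typed Γ Δ t (.all A) → Typed Γ Δ t (A.inst L)
  | impE {Γ₁ Γ₂ Δ : Ctx} {t u : Term} {A B : Fm} : Distinct (Γ₁ + Γ₂) Δ →
      Typed Γ₁ Δ t (.imp A B) → Typed Γ₂ 0 u A → Typed (Γ₁ + Γ₂) Δ (.app t u) B
  | impI {Γ Δ : Ctx} {z : ℕ} {t : Term} {A B : Fm} :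
      Typed ((z, A) ::ₘ Γ) Δ t B → Typed Γ Δ (Term.lamVar z t) (.imp A B)
  | lolliE {Γ₁ Γ₂ Δ₁ Δ₂ : Ctx} {t u : Term} {L B : Fm} : Distinct (Γ₁ + Γ₂) (Δ₁ + Δ₂) →
      Typed Γ₁ Δ₁ t (.lolli L B) → Typed Γ₂ Δ₂ u L →
      Typed (Γ₁ + Γ₂) (Δ₁ + Δ₂) (.app t u) B
  | lolliI {Γ Δ : Ctx} {z : ℕ} {t : Term} {L B : Fm} :
      Typed Γ ((z, L) ::ₘ Δ) t B → Typed Γ Δ (Term.lamVar z t) (.lolli L B)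
  | contr {Γ Δ : Ctx} {x y z : ℕ} {t : Term} {A B : Fm} : Distinct ((z, A) ::ₘ Γ) Δ →
      Typed ((x, A) ::ₘ (y, A) ::ₘ Γ) Δ t B →
      Typed ((z, A) ::ₘ Γ) Δ (t.rename fun v => if v = x ∨ v = y then z else v) B
  | derel {Γ Δ : Ctx} {x : ℕ} {t : Term} {L B : Fm} :
      Typed Γ ((x, L) ::ₘ Δ) t B → Typed ((x, L) ::ₘ Γ) Δ t B
  | weak {Γ Γ' Δ Δ' : Ctx} {t : Term} {B : Fm} : Distinct (Γ + Γ') (Δ + Δ') →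
      (∀ p ∈ Γ', p.2.IsFormula) → (∀ p ∈ Δ', p.2.IsLinear) →
      Typed Γ Δ t B → Typed (Γ + Γ') (Δ + Δ') t B

/-! ### Church words -/

/-- `∀ α. (α ⊸ α) ⇒ (α ⊸ α) ⇒ (α ⊸ α)`. -/
def churchW : Fm :=
  .all (.imp (.lolli (.var 0) (.var 0))
    (.imp (.lolli (.var 0) (.var 0)) (.lolli (.var 0) (.var 0))))

/-- `λ f₀ f₁ x. f_{i₁} (f_{i₂} (⋯ (f_{iₙ} x) ⋯))` for `w = i₁ ⋯ iₙ` (`true` is the letter `1`). -/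
def churchWord (w : List Bool) : Term :=
  .lam (.lam (.lam
    (w.foldr (fun i s => .app (.var (if i then 1 else 2)) s) (.var 0))))

end DIAL

/-! Every linear formula is erased to one type `base`, inhabited by the families of terms, indexed
by words, that reduce to affine terms whose number of applications is polynomial in the length of
the word. Each family carries a multiset of resources, which at `base` bounds the free occurrences
of the affine reducts. Applying affine terms, and abstracting a variable that occurs at most once,
stays inside `base` and only adds sizes. Hence `base ⊸ base` can again be `base`, and the
quantifiers and fixed points of linear formulas need no interpretation of their own. Only `⇒`, and
`⊸` with a codomain other than `base`, become function spaces of a logical relation. An argument of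
`⇒` has no resources, so it may be duplicated freely.

`Typed.reducible` is the fundamental lemma. By `reducible_churchWord`, Church words are reducible:
if the two step functions reduce to closed affine terms, iterating them along a word of length n is
affine in the starting point, and the sizes of n copies are added, never multiplied together. So `t`
applied to a Church word reduces to an affine term of polynomial size. By `Beta.affine`, reduction
shrinks affine terms, so the normal form obeys the same bound; confluence makes it unique. -/

namespace DIAL

/-! ### Renaming and substitution -/

namespace Term

theorem upRen_comp (ρ τ : ℕ → ℕ) : (fun x => upRen τ (upRen ρ x)) = upRen fun x => τ (ρ x) := by
  funext x; cases x <;> rfl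

theorem rename_rename (t : Term) (ρ τ : ℕ → ℕ) :
    (t.rename ρ).rename τ = t.rename fun x => τ (ρ x) := by
  induction t generalizing ρ τ with
  | var x => rfl
  | lam t ih => simp only [rename, ih, upRen_comp]
  | app t u iht ihu => simp only [rename, iht, ihu]

theorem rename_subst (t : Term) (ρ : ℕ → ℕ) (σ : ℕ → Term) :
    (t.rename ρ).subst σ = t.subst fun x => σ (ρ x) := by
  induction t generalizing ρ σ with
  | var x => rfl
  | lam t ih =>
    simp only [rename, subst, ih]
    congr 2; funext x; cases x <;> rfl
  | app t u iht ihu => simp only [rename, subst, iht, ihu]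

theorem subst_rename (t : Term) (σ : ℕ → Term) (ρ : ℕ → ℕ) :
    (t.subst σ).rename ρ = t.subst fun x => (σ x).rename ρ := by
  induction t generalizing ρ σ with
  | var x => rfl
  | lam t ih =>
    simp only [rename, subst, ih]
    congr 2; funext x
    cases x with
    | zero => rfl
    | succ x => simp only [up, rename_rename]; rfl
  | app t u iht ihu => simp only [rename, subst, iht, ihu]

theorem subst_subst (t : Term) (σ τ : ℕ → Term) :
    (t.subst σ).subst τ = t.subst fun x => (σ x).subst τ := by
  induction t generalizing σ τ with
  | var x => rfl
  | lam t ih =>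
    simp only [subst, ih]
    congr 2; funext x
    cases x with
    | zero => rfl
    | succ x => simp only [up, rename_subst, subst_rename]
  | app t u iht ihu => simp only [subst, iht, ihu]

theorem up_var : up var = var := by
  funext x; cases x <;> rfl

theorem subst_var (t : Term) : t.subst var = t := by
  induction t with
  | var x => rfl
  | lam t ih => simp only [subst, up_var, ih]
  | app t u iht ihu => simp only [subst, iht, ihu]

theorem rename_eq_subst (t : Term) (ρ : ℕ → ℕ) : t.rename ρ = t.subst fun x => var (ρ x) := by
  rw [← subst_var (t.rename ρ), rename_subst]

theorem rename_id (t : Term) : (t.rename fun x => x) = t := by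
  rw [rename_eq_subst]; exact subst_var t

theorem rename_succ_inst (t u : Term) : (t.rename Nat.succ).inst u = t := by
  rw [inst, rename_subst]; exact subst_var t

theorem rename_inst (t u : Term) (ρ : ℕ → ℕ) :
    (t.inst u).rename ρ = (t.rename (upRen ρ)).inst (u.rename ρ) := by
  simp only [inst, subst_rename, rename_subst]
  congr 1; funext x; cases x <;> rfl

theorem inst_subst (t u : Term) (σ : ℕ → Term) :
    (t.inst u).subst σ = (t.subst (up σ)).inst (u.subst σ) := by
  simp only [inst, subst_subst]
  congr 1; funext x
  cases x with
  | zero => rfl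
  | succ x => exact (rename_succ_inst (σ x) (u.subst σ)).symm

/-- Opens a named abstraction: the bound name becomes the index 0 and the other images are shifted
past the binder. -/
theorem lamVar_subst (z : ℕ) (t : Term) (σ : ℕ → Term) :
    (lamVar z t).subst σ =
      lam (t.subst (Function.update (fun x => (σ x).rename Nat.succ) z (var 0))) := by
  simp only [lamVar, subst, rename_subst]
  congr 2; funext x
  by_cases h : x = z
  · subst h; simp [bindIdx, up]
  · simp [bindIdx, up, h]

/-- The body of an abstraction `(lamVar z t).subst σ`, renamed by `ρ` and applied to `u`. -/
theorem lamVar_subst_rename_inst (z : ℕ) (t u : Term) (σ : ℕ → Term) (ρ : ℕ → ℕ) :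
    (((t.rename (bindIdx z)).subst (up σ)).rename (upRen ρ)).inst u =
      t.subst (Function.update (fun x => (σ x).rename ρ) z u) := by
  simp only [inst, rename_subst, subst_rename, subst_subst]
  congr 1; funext x
  by_cases h : x = z
  · subst h; simp [bindIdx, up, upRen, subst, single]
  · simp only [bindIdx, up, h, if_false, ne_eq, not_false_eq_true, Function.update_of_ne,
      rename_subst]
    exact (rename_eq_subst _ _).symm

end Term

/-! ### Many-step reduction -/

/-- Many-step beta-reduction. -/
abbrev BetaStar : Term → Term → Prop := Relation.ReflTransGen Beta

theorem Beta.rename {t t' : Term} (h : Beta t t') (ρ : ℕ → ℕ) :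
    Beta (t.rename ρ) (t'.rename ρ) := by
  induction h generalizing ρ with
  | redex t u => rw [Term.rename_inst]; exact .redex _ _
  | lam _ ih => exact .lam (ih _)
  | appL u _ ih => exact .appL _ (ih _)
  | appR t _ ih => exact .appR _ (ih _)

theorem BetaStar.rename {t t' : Term} (h : BetaStar t t') (ρ : ℕ → ℕ) :
    BetaStar (t.rename ρ) (t'.rename ρ) :=
  h.lift _ fun _ _ h => h.rename ρ

theorem BetaStar.lam {t t' : Term} (h : BetaStar t t') : BetaStar (.lam t) (.lam t') :=
  Relation.ReflTransGen.lift Term.lam (fun _ _ => Beta.lam) _ _ h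

theorem BetaStar.app {t t' u u' : Term} (ht : BetaStar t t') (hu : BetaStar u u') :
    BetaStar (.app t u) (.app t' u') :=
  (Relation.ReflTransGen.lift (fun t => Term.app t u) (fun _ _ => Beta.appL u) _ _ ht).trans
    (Relation.ReflTransGen.lift (Term.app t') (fun _ _ => Beta.appR t') _ _ hu)

/-! ### Confluence -/

/-- Parallel beta-reduction. -/
inductive Par : Term → Term → Prop where
  | var (x : ℕ) : Par (.var x) (.var x)
  | lam {t t' : Term} : Par t t' → Par (.lam t) (.lam t')
  | app {t t' u u' : Term} : Par t t' → Par u u' → Par (.app t u) (.app t' u')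
  | redex {t t' u u' : Term} : Par t t' → Par u u' → Par (.app (.lam t) u) (t'.inst u')

namespace Par

theorem refl (t : Term) : Par t t := by
  induction t with
  | var x => exact .var x
  | lam t ih => exact .lam ih
  | app t u iht ihu => exact .app iht ihu

theorem of_beta {t t' : Term} (h : Beta t t') : Par t t' := by
  induction h with
  | redex t u => exact .redex (refl t) (refl u)
  | lam _ ih => exact .lam ih
  | appL u _ ih => exact .app ih (refl u)
  | appR t _ ih => exact .app (refl t) ih

theorem betaStar {t t' : Term} (h : Par t t') : BetaStar t t' := by
  induction h with
  | var x => exact .refl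
  | lam _ ih => exact ih.lam
  | app _ _ iht ihu => exact iht.app ihu
  | redex _ _ iht ihu => exact (iht.lam.app ihu).tail (.redex _ _)

theorem rename {t t' : Term} (h : Par t t') (ρ : ℕ → ℕ) : Par (t.rename ρ) (t'.rename ρ) := by
  induction h generalizing ρ with
  | var x => exact .var _
  | lam _ ih => exact .lam (ih _)
  | app _ _ iht ihu => exact .app (iht _) (ihu _)
  | redex _ _ iht ihu => rw [Term.rename_inst]; exact .redex (iht _) (ihu _)

theorem up {σ τ : ℕ → Term} (h : ∀ x, Par (σ x) (τ x)) (x : ℕ) :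
    Par (Term.up σ x) (Term.up τ x) := by
  cases x with
  | zero => exact .var 0
  | succ x => exact (h x).rename _

theorem subst {t t' : Term} (h : Par t t') {σ τ : ℕ → Term} (hσ : ∀ x, Par (σ x) (τ x)) :
    Par (t.subst σ) (t'.subst τ) := by
  induction h generalizing σ τ with
  | var x => exact hσ x
  | lam _ ih => exact .lam (ih (up hσ))
  | app _ _ iht ihu => exact .app (iht hσ) (ihu hσ)
  | redex _ _ iht ihu => rw [Term.inst_subst]; exact .redex (iht (up hσ)) (ihu hσ)

theorem inst {t t' u u' : Term} (ht : Par t t') (hu : Par u u') :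
    Par (t.inst u) (t'.inst u') :=
  ht.subst fun x => by
    cases x with
    | zero => exact hu
    | succ x => exact .var x

end Par

/-- The complete development of a term. -/
def Term.develop : Term → Term
  | .var x => .var x
  | .lam t => .lam t.develop
  | .app (.lam t) u => t.develop.inst u.develop
  | .app (.var x) u => .app (.var x) u.develop
  | .app (.app t s) u => .app (Term.app t s).develop u.develop

/-- A parallel step contracts some of the redexes of the term; contracting what is left of the
others leads to the complete development. This triangle property yields the diamond property. -/
theorem Par.develop {t t' : Term} (h : Par t t') : Par t' t.develop := by
  induction h with
  | var x => exact .var x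
  | lam _ ih => exact .lam ih
  | @app t t' u u' ht _ iht ihu =>
    cases t with
    | var x => exact .app iht ihu
    | app t s => exact .app iht ihu
    | lam t =>
      cases ht with
      | lam ht =>
        cases iht with
        | lam iht => exact .redex iht ihu
  | redex _ _ iht ihu => exact iht.inst ihu

/-- Parallel reduction lies between one-step and many-step reduction, so its diamond property
transfers. -/
theorem beta_confluent {t u v : Term} (hu : BetaStar t u) (hv : BetaStar t v) :
    ∃ s, BetaStar u s ∧ BetaStar v s := by
  have lift {a b : Term} : BetaStar a b → Relation.ReflTransGen Par a b :=
    Relation.ReflTransGen.mono (fun _ _ => Par.of_beta) a b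
  have lower {a b : Term} (h : Relation.ReflTransGen Par a b) : BetaStar a b := by
    induction h with
    | refl => exact .refl
    | tail _ h ih => exact ih.trans h.betaStar
  obtain ⟨s, hus, hvs⟩ := Relation.church_rosser
    (fun a _ _ hb hc => ⟨a.develop, .single hb.develop, .single hc.develop⟩) (lift hu) (lift hv)
  exact ⟨s, lower hus, lower hvs⟩

theorem BetaStar.eq_of_normal {t u : Term} (h : BetaStar t u) (ht : ∀ v, ¬ Beta t v) : t = u := by
  rcases h.cases_head with h | ⟨v, hv, _⟩
  · exact h
  · exact absurd hv (ht v)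

theorem IsBetaNF.unique {t u v : Term} (hu : IsBetaNF t u) (hv : IsBetaNF t v) : u = v := by
  obtain ⟨s, hus, hvs⟩ := beta_confluent hu.1 hv.1
  exact (hus.eq_of_normal hu.2).trans (hvs.eq_of_normal hv.2).symm

/-! ### Affine terms -/

/-- The multiset left of the free indices of the body of a binder. -/
def lowerIdx (s : Multiset ℕ) : Multiset ℕ := (s.filter (· ≠ 0)).map Nat.pred

/-- The multiset of the free variable occurrences of a term. -/
def Term.fv : Term → Multiset ℕ
  | .var x => {x}
  | .lam t => lowerIdx t.fv
  | .app t u => t.fv + u.fv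

/-- Every abstraction binds at most one occurrence. -/
def Term.Affine : Term → Prop
  | .var _ => True
  | .lam t => t.Affine ∧ t.fv.count 0 ≤ 1
  | .app t u => t.Affine ∧ u.Affine

@[simp] theorem lowerIdx_zero : lowerIdx 0 = 0 := rfl

@[simp] theorem lowerIdx_add (s t : Multiset ℕ) : lowerIdx (s + t) = lowerIdx s + lowerIdx t := by
  simp [lowerIdx]

@[simp] theorem lowerIdx_singleton_zero : lowerIdx {0} = 0 := rfl

@[simp] theorem lowerIdx_singleton_succ (n : ℕ) : lowerIdx {n + 1} = {n} := rfl

@[simp] theorem lowerIdx_map_succ (s : Multiset ℕ) : lowerIdx (s.map Nat.succ) = s := by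
  induction s using Multiset.induction_on with
  | empty => rfl
  | cons n s ih => rw [← Multiset.singleton_add, Multiset.map_add, lowerIdx_add, ih]; rfl

theorem lowerIdx_mono {s t : Multiset ℕ} (h : s ≤ t) : lowerIdx s ≤ lowerIdx t :=
  Multiset.map_le_map (Multiset.filter_le_filter _ h)

/-- The binder case of computing free occurrences, for renamings and substitutions alike: the bound
index contributes nothing after lowering. -/
theorem lowerIdx_bind (s : Multiset ℕ) (f g : ℕ → Multiset ℕ) (h₀ : lowerIdx (f 0) = 0)
    (h : ∀ n, lowerIdx (f (n + 1)) = g n) : lowerIdx (s.bind f) = (lowerIdx s).bind g := by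
  induction s using Multiset.induction_on with
  | empty => rfl
  | cons n s ih =>
    rw [← Multiset.singleton_add, Multiset.add_bind, lowerIdx_add, lowerIdx_add, ih,
      Multiset.add_bind, Multiset.singleton_bind]
    cases n with
    | zero => simp [h₀]
    | succ n => simp [h]

theorem count_zero_map_succ (s : Multiset ℕ) : (s.map Nat.succ).count 0 = 0 := by
  simp

theorem count_zero_bind (s : Multiset ℕ) (f : ℕ → Multiset ℕ) (h₀ : f 0 = {0})
    (h : ∀ n, (f (n + 1)).count 0 = 0) : (s.bind f).count 0 = s.count 0 := by
  induction s using Multiset.induction_on with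
  | empty => rfl
  | cons n s ih =>
    rw [Multiset.cons_bind, Multiset.count_add, ih]
    cases n with
    | zero => simp [h₀, add_comm]
    | succ n => simp [h]

/-! ### Free occurrences and size under renaming and substitution. -/

namespace Term

theorem fv_rename (t : Term) (ρ : ℕ → ℕ) : (t.rename ρ).fv = t.fv.map ρ := by
  induction t generalizing ρ with
  | var x => rfl
  | app t u iht ihu => simp [rename, fv, iht, ihu]
  | lam t ih =>
    simp only [rename, fv, ih]
    rw [← Multiset.bind_singleton, ← Multiset.bind_singleton]
    exact lowerIdx_bind _ _ _ rfl fun _ => rfl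

theorem fv_subst (t : Term) (σ : ℕ → Term) : (t.subst σ).fv = t.fv.bind fun x => (σ x).fv := by
  induction t generalizing σ with
  | var x => simp [subst, fv]
  | app t u iht ihu => simp [subst, fv, iht, ihu]
  | lam t ih =>
    simp only [subst, fv, ih]
    exact lowerIdx_bind _ _ _ rfl fun n => by
      simp only [up, fv_rename, lowerIdx_map_succ]

theorem count_zero_fv_subst_up (t : Term) (σ : ℕ → Term) :
    (t.subst (up σ)).fv.count 0 = t.fv.count 0 := by
  rw [fv_subst]
  exact count_zero_bind _ _ rfl fun n => by
    simp only [up, fv_rename, count_zero_map_succ]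

theorem Affine.rename {t : Term} (h : t.Affine) (ρ : ℕ → ℕ) : (t.rename ρ).Affine := by
  induction t generalizing ρ with
  | var x => trivial
  | app t u iht ihu => exact ⟨iht h.1 ρ, ihu h.2 ρ⟩
  | lam t ih =>
    refine ⟨ih h.1 _, ?_⟩
    rw [fv_rename, ← Multiset.bind_singleton, count_zero_bind]
    · exact h.2
    · rfl
    · intro n; simp [upRen]

/-- Affinity restricts only bound occurrences, and capture-avoiding substitution adds none to the
abstractions of `t`. Free variables may therefore be duplicated. -/
theorem Affine.subst {t : Term} (h : t.Affine) {σ : ℕ → Term} (hσ : ∀ x, (σ x).Affine) :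
    (t.subst σ).Affine := by
  induction t generalizing σ with
  | var x => exact hσ x
  | app t u iht ihu => exact ⟨iht h.1 hσ, ihu h.2 hσ⟩
  | lam t ih =>
    refine ⟨ih h.1 fun x => ?_, (count_zero_fv_subst_up t σ).trans_le h.2⟩
    cases x with
    | zero => trivial
    | succ x => exact (hσ x).rename _

theorem Affine.inst {t u : Term} (ht : t.Affine) (hu : u.Affine) : (t.inst u).Affine :=
  ht.subst fun x => by
    cases x with
    | zero => exact hu
    | succ x => trivial

theorem apps_rename (t : Term) (ρ : ℕ → ℕ) : (t.rename ρ).apps = t.apps := by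
  induction t generalizing ρ with
  | var x => rfl
  | lam t ih => exact ih _
  | app t u iht ihu => simp only [rename, apps, iht, ihu]

theorem sum_map_lowerIdx (s : Multiset ℕ) (f g : ℕ → ℕ) (h₀ : f 0 = 0)
    (h : ∀ n, f (n + 1) = g n) : (s.map f).sum = ((lowerIdx s).map g).sum := by
  induction s using Multiset.induction_on with
  | empty => rfl
  | cons n s ih =>
    rw [← Multiset.singleton_add, lowerIdx_add]
    cases n with
    | zero => simp [h₀, ih]
    | succ n => simp [h, ih]

theorem apps_subst (t : Term) (σ : ℕ → Term) :
    (t.subst σ).apps = t.apps + (t.fv.map fun x => (σ x).apps).sum := by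
  induction t generalizing σ with
  | var x => simp [subst, fv, apps]
  | app t u iht ihu => simp [subst, fv, apps, iht, ihu]; omega
  | lam t ih =>
    simp only [subst, fv, apps, ih]
    congr 1
    exact sum_map_lowerIdx _ _ _ rfl fun n => by simp [up, apps_rename]

theorem apps_inst (t u : Term) : (t.inst u).apps = t.apps + t.fv.count 0 * u.apps := by
  rw [inst, apps_subst]
  congr 1
  induction t.fv using Multiset.induction_on with
  | empty => simp
  | cons n s ih =>
    rw [Multiset.map_cons, Multiset.sum_cons, ih]
    cases n with
    | zero => simp [single]; ring
    | succ n => simp [single, apps]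

theorem fv_inst (t u : Term) : (t.inst u).fv = lowerIdx t.fv + t.fv.count 0 • u.fv := by
  rw [inst, fv_subst]
  induction t.fv using Multiset.induction_on with
  | empty => simp
  | cons n s ih =>
    rw [Multiset.cons_bind, ih, ← Multiset.singleton_add, lowerIdx_add]
    cases n with
    | zero => simp [single, add_nsmul]; abel
    | succ n => simp [single, fv]

end Term

/-- A reduction step of an affine term yields a smaller affine term. -/
theorem Beta.affine {t t' : Term} (h : Beta t t') (ht : t.Affine) :
    t'.Affine ∧ t'.fv ≤ t.fv ∧ t'.apps < t.apps := by
  induction h with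
  | redex t u =>
    obtain ⟨⟨ht, h1⟩, hu⟩ := ht
    -- At most one copy of the argument is made, and the contracted application disappears.
    refine ⟨ht.inst hu, ?_, ?_⟩
    · rw [Term.fv_inst]
      refine add_le_add_right ?_ _
      calc _ ≤ 1 • u.fv := nsmul_le_nsmul_left (Multiset.zero_le _) h1
        _ = u.fv := one_nsmul _
    · rw [Term.apps_inst]
      have := Nat.mul_le_mul_right u.apps h1
      simp only [Term.apps]
      omega
  | lam _ ih =>
    obtain ⟨h1, h2, h3⟩ := ih ht.1
    exact ⟨⟨h1, (Multiset.count_le_of_le 0 h2).trans ht.2⟩, lowerIdx_mono h2, h3⟩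
  | appL u _ ih =>
    obtain ⟨h1, h2, h3⟩ := ih ht.1
    exact ⟨⟨h1, ht.2⟩, add_le_add_left h2 _, by simp only [Term.apps]; omega⟩
  | appR t _ ih =>
    obtain ⟨h1, h2, h3⟩ := ih ht.2
    exact ⟨⟨ht.1, h1⟩, add_le_add_right h2 _, by simp only [Term.apps]; omega⟩

theorem Term.Affine.exists_isBetaNF {t : Term} (ht : t.Affine) :
    ∃ u, IsBetaNF t u ∧ u.apps ≤ t.apps := by
  induction hn : t.apps using Nat.strong_induction_on generalizing t with
  | _ n ih =>
    by_cases h : ∃ t', Beta t t'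
    · obtain ⟨t', h⟩ := h
      obtain ⟨h1, -, h3⟩ := h.affine ht
      obtain ⟨u, hu, hle⟩ := ih _ (hn ▸ h3) h1 rfl
      exact ⟨u, ⟨hu.1.head h, hu.2⟩, by omega⟩
    · push Not at h
      exact ⟨t, ⟨.refl, h⟩, hn.le⟩

/-! ### Erasure of formulas to simple types -/

/-- Simple types over one type `base` of affine terms. -/
inductive Ty : Type where
  | base : Ty
  | lin : Ty → Ty
  | imp : Ty → Ty → Ty

/-- The type of the functions from `base` to a type, where `base ⊸ base` is `base`. -/
def Ty.lolli : Ty → Ty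
  | .base => .base
  | .lin S => .lin (.lin S)
  | .imp S T => .lin (.imp S T)

namespace Fm

/-- The erasure of a formula; every linear formula is erased to `base`. -/
def erase : Fm → Ty
  | .var _ => .base
  | .all A => A.erase
  | .mu _ => .base
  | .lolli _ B => B.erase.lolli
  | .imp A B => .imp A.erase B.erase

/-- `⇒` does not occur. -/
def ImpFree : Fm → Prop
  | .var _ => True
  | .all A => A.ImpFree
  | .mu A => A.ImpFree
  | .lolli A B => A.ImpFree ∧ B.ImpFree
  | .imp _ _ => False

/-- `⇒` occurs neither to the left of `⊸` nor below `μ`. -/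
def Stratified : Fm → Prop
  | .var _ => True
  | .all A => A.Stratified
  | .mu A => A.ImpFree
  | .lolli A B => A.ImpFree ∧ B.Stratified
  | .imp A B => A.Stratified ∧ B.Stratified

theorem ImpFree.stratified {A : Fm} (h : A.ImpFree) : A.Stratified := by
  induction A with
  | var => trivial
  | all A ih => exact ih h
  | mu A => exact h
  | lolli A B _ ih => exact ⟨h.1, ih h.2⟩
  | imp => exact h.elim

theorem ImpFree.erase {A : Fm} (h : A.ImpFree) : A.erase = .base := by
  induction A with
  | var => rfl
  | all A ih => exact ih h
  | mu A => rfl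
  | lolli A B _ ih => rw [Fm.erase, ih h.2]; rfl
  | imp => exact h.elim

theorem IsLinear.impFree {A : Fm} (h : A.IsLinear) : A.ImpFree := by
  induction A with
  | var => trivial
  | all A ih => exact ih h
  | mu A ih => exact ih h.1
  | lolli A B ihA ihB => exact ⟨ihA h.1, ihB h.2⟩
  | imp => exact h.elim

theorem IsFormula.stratified {A : Fm} (h : A.IsFormula) : A.Stratified := by
  induction h with
  | linear h => exact h.impFree.stratified
  | all _ ih => exact ih
  | lolli hL _ ih => exact ⟨hL.impFree, ih⟩
  | imp _ _ ihA ihB => exact ⟨ihA, ihB⟩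

theorem ImpFree.rename {A : Fm} (h : A.ImpFree) (ρ : ℕ → ℕ) : (A.rename ρ).ImpFree := by
  induction A generalizing ρ with
  | var => trivial
  | all A ih => exact ih h _
  | mu A ih => exact ih h _
  | lolli A B ihA ihB => exact ⟨ihA h.1 _, ihB h.2 _⟩
  | imp => exact h.elim

theorem Stratified.rename {A : Fm} (h : A.Stratified) (ρ : ℕ → ℕ) :
    (A.rename ρ).Stratified := by
  induction A generalizing ρ with
  | var => trivial
  | all A ih => exact ih h _
  | mu A ih => exact ImpFree.rename (A := A) h _
  | lolli A B ihA ihB => exact ⟨h.1.rename _, ihB h.2 _⟩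
  | imp A B ihA ihB => exact ⟨ihA h.1 _, ihB h.2 _⟩

theorem erase_rename (A : Fm) (ρ : ℕ → ℕ) : (A.rename ρ).erase = A.erase := by
  induction A generalizing ρ with
  | var => rfl
  | all A ih => exact ih _
  | mu A ih => rfl
  | lolli A B ihA ihB => simp only [Fm.rename, Fm.erase, ihB]
  | imp A B ihA ihB => simp only [Fm.rename, Fm.erase, ihA, ihB]

theorem ImpFree.up {σ : ℕ → Fm} (hσ : ∀ x, (σ x).ImpFree) (x : ℕ) : (Fm.up σ x).ImpFree := by
  cases x with
  | zero => trivial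
  | succ x => exact (hσ x).rename _

theorem ImpFree.subst {A : Fm} (h : A.ImpFree) {σ : ℕ → Fm} (hσ : ∀ x, (σ x).ImpFree) :
    (A.subst σ).ImpFree := by
  induction A generalizing σ with
  | var x => exact hσ x
  | all A ih => exact ih h (up hσ)
  | mu A ih => exact ih h (up hσ)
  | lolli A B ihA ihB => exact ⟨ihA h.1 hσ, ihB h.2 hσ⟩
  | imp => exact h.elim

theorem Stratified.subst {A : Fm} (h : A.Stratified) {σ : ℕ → Fm} (hσ : ∀ x, (σ x).ImpFree) :
    (A.subst σ).Stratified := by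
  induction A generalizing σ with
  | var x => exact (hσ x).stratified
  | all A ih => exact ih h (ImpFree.up hσ)
  | mu A ih => exact ImpFree.subst (A := A) h (ImpFree.up hσ)
  | lolli A B ihA ihB => exact ⟨h.1.subst hσ, ihB h.2 hσ⟩
  | imp A B ihA ihB => exact ⟨ihA h.1 hσ, ihB h.2 hσ⟩

/-- Variables are already erased to `base`, as are the formulas substituted for them. -/
theorem erase_subst (A : Fm) {σ : ℕ → Fm} (hσ : ∀ x, (σ x).ImpFree) :
    (A.subst σ).erase = A.erase := by
  induction A generalizing σ with
  | var x => exact (hσ x).erase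
  | all A ih => exact ih (ImpFree.up hσ)
  | mu A ih => rfl
  | lolli A B ihA ihB => simp only [Fm.subst, Fm.erase, ihB hσ]
  | imp A B ihA ihB => simp only [Fm.subst, Fm.erase, ihA hσ, ihB hσ]

theorem ImpFree.single {L : Fm} (h : L.ImpFree) (x : ℕ) : (Fm.single L x).ImpFree := by
  cases x with
  | zero => exact h
  | succ x => trivial

end Fm

/-! ### Invariants of derivable judgments -/

theorem Typed.distinct {Γ Δ : Ctx} {t : Term} {A : Fm} (h : Typed Γ Δ t A) : Distinct Γ Δ := by
  induction h with
  | ax1 | ax2 => simp [Distinct]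
  | muE _ ih | muI _ _ ih | allI _ _ _ ih | allE _ _ ih => exact ih
  | impE h | lolliE h | contr h | weak h => exact h
  | impI _ ih =>
    rw [Distinct, Multiset.cons_add, Multiset.map_cons, Multiset.nodup_cons] at ih
    exact ih.2
  | lolliI _ ih =>
    rw [Distinct, Multiset.add_cons, Multiset.map_cons, Multiset.nodup_cons] at ih
    exact ih.2
  | derel _ ih =>
    rw [Distinct, Multiset.add_cons] at ih
    rwa [Distinct, Multiset.cons_add]

/-- `Stratified` and `ImpFree` drop the positivity condition on `μ`, so that their stability under
substitution needs no tracking of polarities. -/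
theorem Typed.stratified {Γ Δ : Ctx} {t : Term} {A : Fm} (h : Typed Γ Δ t A) :
    A.Stratified ∧ (∀ p ∈ Γ, p.2.Stratified) ∧ ∀ p ∈ Δ, p.2.ImpFree := by
  induction h with
  | ax1 x h => simpa using h.stratified
  | ax2 x h => simpa using ⟨h.impFree.stratified, h.impFree⟩
  | @muE _ _ _ L _ ih =>
    have h : L.ImpFree := ih.1
    exact ⟨(h.subst (Fm.ImpFree.single (L := .mu L) h)).stratified, ih.2⟩
  | muI hL _ ih => exact ⟨hL.impFree.stratified, ih.2⟩
  | allI α _ _ ih => exact ⟨Fm.Stratified.rename (A := _) ih.1 _, ih.2⟩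
  | @allE _ _ _ A L hL _ ih =>
    exact ⟨Fm.Stratified.subst (A := A) ih.1 hL.impFree.single, ih.2⟩
  | impE _ _ _ iht ihu =>
    refine ⟨iht.1.2, fun p hp => ?_, iht.2.2⟩
    exact (Multiset.mem_add.1 hp).elim (iht.2.1 p) (ihu.2.1 p)
  | lolliE _ _ _ iht ihu =>
    refine ⟨iht.1.2, fun p hp => ?_, fun p hp => ?_⟩
    · exact (Multiset.mem_add.1 hp).elim (iht.2.1 p) (ihu.2.1 p)
    · exact (Multiset.mem_add.1 hp).elim (iht.2.2 p) (ihu.2.2 p)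
  | impI _ ih =>
    simp only [Multiset.forall_mem_cons] at ih
    exact ⟨⟨ih.2.1.1, ih.1⟩, ih.2.1.2, ih.2.2⟩
  | lolliI _ ih =>
    simp only [Multiset.forall_mem_cons] at ih
    exact ⟨⟨ih.2.2.1, ih.1⟩, ih.2.1, ih.2.2.2⟩
  | contr _ _ ih =>
    simp only [Multiset.forall_mem_cons] at ih ⊢
    exact ⟨ih.1, ih.2.1.2, ih.2.2⟩
  | derel _ ih =>
    simp only [Multiset.forall_mem_cons] at ih ⊢
    exact ⟨ih.1, ⟨ih.2.2.1.stratified, ih.2.1⟩, ih.2.2.2⟩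
  | weak _ hΓ hΔ _ ih =>
    refine ⟨ih.1, fun p hp => ?_, fun p hp => ?_⟩
    · exact (Multiset.mem_add.1 hp).elim (ih.2.1 p) fun h => (hΓ p h).stratified
    · exact (Multiset.mem_add.1 hp).elim (ih.2.2 p) fun h => (hΔ p h).impFree

/-! ### The logical relation -/

/-- The family `f` reduces to affine terms of polynomially bounded size, whose free variable
occurrences are among `D`. -/
def AffineReducible (D : Multiset ℕ) (f : List Bool → Term) : Prop :=
  ∃ P : Polynomial ℕ, ∀ w, ∃ a : Term,
    BetaStar (f w) a ∧ a.Affine ∧ a.fv ≤ D ∧ a.apps ≤ P.eval w.length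

/-- Reducible families of terms of a given type which use the resources `D` once. -/
def Reducible : Ty → Multiset ℕ → (List Bool → Term) → Prop
  | .base, D, f => AffineReducible D f
  | .lin T, D, f => ∀ (ρ : ℕ → ℕ) (E : Multiset ℕ) (g : List Bool → Term), AffineReducible E g →
      Reducible T (D.map ρ + E) fun w => .app ((f w).rename ρ) (g w)
  | .imp S T, D, f => ∀ (ρ : ℕ → ℕ) (g : List Bool → Term), Reducible S 0 g →
      Reducible T (D.map ρ) fun w => .app ((f w).rename ρ) (g w)

/-! ### Closure properties of reducible families. -/

namespace Reducible

theorem mono {S : Ty} {D E : Multiset ℕ} {f : List Bool → Term} (h : Reducible S D f)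
    (hDE : D ≤ E) : Reducible S E f := by
  induction S generalizing D E f with
  | base =>
    obtain ⟨P, hP⟩ := h
    refine ⟨P, fun w => ?_⟩
    obtain ⟨a, h1, h2, h3, h4⟩ := hP w
    exact ⟨a, h1, h2, h3.trans hDE, h4⟩
  | lin T ih =>
    exact fun ρ F g hg => ih (h ρ F g hg) (add_le_add_left (Multiset.map_le_map hDE) _)
  | imp S T _ ih => exact fun ρ g hg => ih (h ρ g hg) (Multiset.map_le_map hDE)

/-- At function types the renaming is absorbed by the one quantified in `Reducible`. -/
theorem rename {S : Ty} {D : Multiset ℕ} {f : List Bool → Term} (h : Reducible S D f)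
    (ρ : ℕ → ℕ) : Reducible S (D.map ρ) fun w => (f w).rename ρ := by
  cases S with
  | base =>
    obtain ⟨P, hP⟩ := h
    refine ⟨P, fun w => ?_⟩
    obtain ⟨a, h1, h2, h3, h4⟩ := hP w
    refine ⟨a.rename ρ, h1.rename ρ, h2.rename ρ, ?_, (a.apps_rename ρ).trans_le h4⟩
    rw [Term.fv_rename]
    exact Multiset.map_le_map h3
  | lin T =>
    intro τ E g hg
    simp only [Multiset.map_map, Term.rename_rename]
    exact h _ E g hg
  | imp S T =>
    intro τ g hg
    simp only [Multiset.map_map, Term.rename_rename]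
    exact h _ g hg

theorem expand {S : Ty} {D : Multiset ℕ} {f f' : List Bool → Term} (h : Reducible S D f')
    (hf : ∀ w, BetaStar (f w) (f' w)) : Reducible S D f := by
  induction S generalizing D f f' with
  | base =>
    obtain ⟨P, hP⟩ := h
    refine ⟨P, fun w => ?_⟩
    obtain ⟨a, h1, h2⟩ := hP w
    exact ⟨a, (hf w).trans h1, h2⟩
  | lin T ih => exact fun ρ E g hg => ih (h ρ E g hg) fun w => ((hf w).rename ρ).app .refl
  | imp S T _ ih => exact fun ρ g hg => ih (h ρ g hg) fun w => ((hf w).rename ρ).app .refl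

theorem app_imp {S T : Ty} {D : Multiset ℕ} {f g : List Bool → Term}
    (hf : Reducible (.imp S T) D f) (hg : Reducible S 0 g) :
    Reducible T D fun w => .app (f w) (g w) := by
  simpa only [Term.rename_id, Multiset.map_id'] using hf (fun x => x) g hg

theorem app_lin {T : Ty} {D E : Multiset ℕ} {f g : List Bool → Term}
    (hf : Reducible (.lin T) D f) (hg : AffineReducible E g) :
    Reducible T (D + E) fun w => .app (f w) (g w) := by
  simpa only [Term.rename_id, Multiset.map_id'] using hf (fun x => x) E g hg

/-- For `base`, where `lolli` is no function space, the application of two affine terms is itself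
affine. -/
theorem app_lolli {T : Ty} {D E : Multiset ℕ} {f g : List Bool → Term}
    (hf : Reducible T.lolli D f) (hg : AffineReducible E g) :
    Reducible T (D + E) fun w => .app (f w) (g w) := by
  cases T with
  | base =>
    obtain ⟨P, hP⟩ := hf
    obtain ⟨Q, hQ⟩ := hg
    -- The summand 1 counts the new application.
    refine ⟨P + Q + 1, fun w => ?_⟩
    obtain ⟨a, ha1, ha2, ha3, ha4⟩ := hP w
    obtain ⟨b, hb1, hb2, hb3, hb4⟩ := hQ w
    refine ⟨.app a b, ha1.app hb1, ⟨ha2, hb2⟩, add_le_add ha3 hb3, ?_⟩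
    simp only [Term.apps, Polynomial.eval_add, Polynomial.eval_one]
    omega
  | lin T => exact hf.app_lin hg
  | imp S T => exact hf.app_lin hg

theorem var_zero : AffineReducible {0} fun _ => .var 0 :=
  ⟨0, fun _ => ⟨.var 0, .refl, trivial, le_rfl, Nat.zero_le _⟩⟩

/-- Index 0 appears once among the resources of the body, so the abstraction is affine. This is why
`base ⊸ base` can be `base`. -/
theorem lam {D : Multiset ℕ} {f : List Bool → Term}
    (hf : AffineReducible ({0} + D.map Nat.succ) f) : AffineReducible D fun w => .lam (f w) := by
  obtain ⟨P, hP⟩ := hf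
  refine ⟨P, fun w => ?_⟩
  obtain ⟨a, h1, h2, h3, h4⟩ := hP w
  refine ⟨.lam a, h1.lam, ⟨h2, ?_⟩, ?_, h4⟩
  · refine (Multiset.count_le_of_le 0 h3).trans ?_
    rw [Multiset.count_add, count_zero_map_succ, Multiset.count_singleton_self]
  · refine (lowerIdx_mono h3).trans_eq ?_
    rw [lowerIdx_add, lowerIdx_map_succ, lowerIdx_singleton_zero, zero_add]

end Reducible

/-! ### Valuations of contexts and the fundamental lemma. -/

/-- The resources assigned by `r` to the variables of a linear context. -/
def resources (r : ℕ → Multiset ℕ) (Δ : Ctx) : Multiset ℕ := (Δ.map fun p => r p.1).sum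

theorem resources_add (r : ℕ → Multiset ℕ) (Δ Δ' : Ctx) :
    resources r (Δ + Δ') = resources r Δ + resources r Δ' := by
  simp [resources]

theorem resources_cons (r : ℕ → Multiset ℕ) (p : ℕ × Fm) (Δ : Ctx) :
    resources r (p ::ₘ Δ) = r p.1 + resources r Δ := by
  simp [resources]

theorem resources_congr {r s : ℕ → Multiset ℕ} {Δ : Ctx} (h : ∀ p ∈ Δ, r p.1 = s p.1) :
    resources r Δ = resources s Δ := by
  rw [resources, Multiset.map_congr rfl h, resources]

theorem resources_map (r : ℕ → Multiset ℕ) (ρ : ℕ → ℕ) (Δ : Ctx) :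
    resources (fun x => (r x).map ρ) Δ = (resources r Δ).map ρ := by
  induction Δ using Multiset.induction_on with
  | empty => rfl
  | cons p Δ ih => rw [resources_cons, resources_cons, ih, Multiset.map_add]

/-- `σ` maps the variables of the contexts to reducible families, which use the resources `r`. -/
structure Valuation (Γ Δ : Ctx) (σ : ℕ → List Bool → Term) (r : ℕ → Multiset ℕ) : Prop where
  imp : ∀ p ∈ Γ, Reducible p.2.erase 0 (σ p.1)
  lin : ∀ p ∈ Δ, AffineReducible (r p.1) (σ p.1)

namespace Valuation

variable {Γ Γ' Δ Δ' : Ctx} {σ : ℕ → List Bool → Term} {r : ℕ → Multiset ℕ}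

theorem mono (h : Valuation Γ Δ σ r) (hΓ : ∀ p ∈ Γ', p ∈ Γ) (hΔ : ∀ p ∈ Δ', p ∈ Δ) :
    Valuation Γ' Δ' σ r :=
  ⟨fun p hp => h.imp p (hΓ p hp), fun p hp => h.lin p (hΔ p hp)⟩

theorem rename (h : Valuation Γ Δ σ r) (ρ : ℕ → ℕ) :
    Valuation Γ Δ (fun x w => (σ x w).rename ρ) fun x => (r x).map ρ :=
  ⟨fun p hp => (h.imp p hp).rename ρ, fun p hp => Reducible.rename (S := .base) (h.lin p hp) ρ⟩

theorem congr {σ' : ℕ → List Bool → Term} {r' : ℕ → Multiset ℕ} (h : Valuation Γ Δ σ r)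
    (hσ : ∀ p ∈ Γ + Δ, σ p.1 = σ' p.1) (hr : ∀ p ∈ Δ, r p.1 = r' p.1) :
    Valuation Γ Δ σ' r' :=
  ⟨fun p hp => hσ p (Multiset.mem_add.2 (.inl hp)) ▸ h.imp p hp,
    fun p hp => hσ p (Multiset.mem_add.2 (.inr hp)) ▸ hr p hp ▸ h.lin p hp⟩

theorem update (h : Valuation Γ Δ σ r) {z : ℕ} (hz : ∀ p ∈ Γ + Δ, p.1 ≠ z)
    (g : List Bool → Term) (E : Multiset ℕ) :
    Valuation Γ Δ (Function.update σ z g) (Function.update r z E) :=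
  h.congr (fun p hp => (Function.update_of_ne (hz p hp) _ _).symm)
    fun p hp => (Function.update_of_ne (hz p (Multiset.mem_add.2 (.inr hp))) _ _).symm

theorem update_imp (h : Valuation Γ Δ σ r) {z : ℕ} (hz : ∀ p ∈ Γ + Δ, p.1 ≠ z) {A : Fm}
    {g : List Bool → Term} (hg : Reducible A.erase 0 g) (E : Multiset ℕ) :
    Valuation ((z, A) ::ₘ Γ) Δ (Function.update σ z g) (Function.update r z E) := by
  refine ⟨?_, (h.update hz g E).lin⟩
  rw [Multiset.forall_mem_cons]
  exact ⟨by simpa using hg, (h.update hz g E).imp⟩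

theorem update_lin (h : Valuation Γ Δ σ r) {z : ℕ} (hz : ∀ p ∈ Γ + Δ, p.1 ≠ z) {L : Fm}
    {g : List Bool → Term} {E : Multiset ℕ} (hg : AffineReducible E g) :
    Valuation Γ ((z, L) ::ₘ Δ) (Function.update σ z g) (Function.update r z E) := by
  refine ⟨(h.update hz g E).imp, ?_⟩
  rw [Multiset.forall_mem_cons]
  exact ⟨by simpa using hg, (h.update hz g E).lin⟩

end Valuation

theorem resources_update {Γ Δ : Ctx} {z : ℕ} (hz : ∀ p ∈ Γ + Δ, p.1 ≠ z) (r : ℕ → Multiset ℕ)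
    (E : Multiset ℕ) : resources (Function.update r z E) Δ = resources r Δ :=
  resources_congr fun p hp => Function.update_of_ne (hz p (Multiset.mem_add.2 (.inr hp))) _ _

theorem Distinct.ne_of_cons {Γ Δ : Ctx} {z : ℕ} {A : Fm} (h : Distinct ((z, A) ::ₘ Γ) Δ) :
    ∀ p ∈ Γ + Δ, p.1 ≠ z := by
  rw [Distinct, Multiset.cons_add, Multiset.map_cons, Multiset.nodup_cons] at h
  exact fun p hp hpz => h.1 (Multiset.mem_map.2 ⟨p, hp, hpz⟩)

theorem Distinct.cons_comm {Γ Δ : Ctx} {p : ℕ × Fm} :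
    Distinct Γ (p ::ₘ Δ) ↔ Distinct (p ::ₘ Γ) Δ := by
  rw [Distinct, Distinct, Multiset.add_cons, Multiset.cons_add]

theorem update_apply_family (σ : ℕ → List Bool → Term) (z : ℕ) (g : List Bool → Term)
    (w : List Bool) :
    (fun x => Function.update σ z g x w) = Function.update (fun x => σ x w) z (g w) := by
  funext x
  by_cases h : x = z
  · subst h; simp
  · simp [h]

/-- Substitution instances of typable terms by reducible families are reducible. -/
theorem Typed.reducible {Γ Δ : Ctx} {t : Term} {A : Fm} (h : Typed Γ Δ t A)
    {σ : ℕ → List Bool → Term} {r : ℕ → Multiset ℕ} (hσ : Valuation Γ Δ σ r) :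
    Reducible A.erase (resources r Δ) fun w => t.subst fun x => σ x w := by
  induction h generalizing σ r with
  | ax1 x hA => exact hσ.imp _ (Multiset.mem_singleton_self _)
  | ax2 x hL =>
    rw [hL.impFree.erase]
    rw [resources, Multiset.map_singleton, Multiset.sum_singleton]
    exact hσ.lin _ (Multiset.mem_singleton_self _)
  -- A fixed point and its unfolding are both erased to `base`.
  | @muE _ _ _ L h ih =>
    have hL : L.ImpFree := h.stratified.1
    rw [Fm.inst, (hL.subst (Fm.ImpFree.single (L := .mu L) hL)).erase]
    exact ih hσ
  | @muI _ _ _ L hL h ih =>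
    have hL : (Fm.mu L).ImpFree := hL.impFree
    have := ih hσ
    rwa [Fm.inst, (Fm.ImpFree.subst (A := L) hL hL.single).erase] at this
  | @allI _ _ _ A α _ _ ih =>
    exact (A.erase_rename (bindIdx α)).symm ▸ ih hσ
  | @allE _ _ _ A L hL _ ih =>
    exact (A.erase_subst hL.impFree.single).symm ▸ ih hσ
  | impE _ _ _ iht ihu =>
    have ht := iht (hσ.mono (fun p hp => Multiset.mem_add.2 (.inl hp)) fun p hp => hp)
    -- The linear context of the argument is empty, hence so are its resources, as `⇒` demands.
    have hu := ihu (hσ.mono (Δ' := 0) (fun p hp => Multiset.mem_add.2 (.inr hp))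
      fun p hp => absurd hp (Multiset.notMem_zero p))
    exact ht.app_imp hu
  | lolliE _ ht _ iht ihu =>
    have ht' := iht (hσ.mono (fun p hp => Multiset.mem_add.2 (.inl hp))
      fun p hp => Multiset.mem_add.2 (.inl hp))
    have hu := ihu (hσ.mono (fun p hp => Multiset.mem_add.2 (.inr hp))
      fun p hp => Multiset.mem_add.2 (.inr hp))
    rw [ht.stratified.1.1.erase] at hu
    rw [resources_add]
    exact ht'.app_lolli hu
  | @impI Γ Δ z t A B h ih =>
    have hz := h.distinct.ne_of_cons
    intro ρ g hg
    -- The resources given to `z` are immaterial, since `z` is not in the linear context; 0 is a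
    -- default.
    have := ih ((hσ.rename ρ).update_imp hz hg 0)
    rw [resources_update hz, resources_map] at this
    refine this.expand fun w => .single ?_
    rw [update_apply_family, ← Term.lamVar_subst_rename_inst]
    exact .redex _ _
  | @lolliI Γ Δ z t L B h ih =>
    have hz := (Distinct.cons_comm.1 h.distinct).ne_of_cons
    have key (ρ : ℕ → ℕ) (E : Multiset ℕ) (g : List Bool → Term) (hg : AffineReducible E g) :
        Reducible B.erase (E + (resources r Δ).map ρ) fun w =>
          t.subst (Function.update (fun x => (σ x w).rename ρ) z (g w)) := by
      have := ih ((hσ.rename ρ).update_lin hz hg)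
      rw [resources_cons, resources_update hz, resources_map, Function.update_self] at this
      simpa only [update_apply_family] using this
    have app : Reducible (.lin B.erase) (resources r Δ) fun w =>
        (Term.lamVar z t).subst fun x => σ x w := by
      intro ρ E g hg
      rw [add_comm]
      refine (key ρ E g hg).expand fun w => .single ?_
      rw [← Term.lamVar_subst_rename_inst]
      exact .redex _ _
    rw [Fm.erase]
    -- With codomain `base`, the abstraction itself must reduce to affine terms: `key` is used under
    -- the binder, with the bound variable as argument. Otherwise the arrow is a function space and
    -- `app` applies.
    cases hB : B.erase with
    | base =>
      rw [hB] at key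
      simp only [Term.lamVar_subst]
      exact Reducible.lam (key Nat.succ _ _ Reducible.var_zero)
    | lin T => rwa [hB] at app
    | imp S T => rwa [hB] at app
  | @contr Γ Δ x y z t A B _ h ih =>
    have hd := h.distinct
    have hx := hd.ne_of_cons
    rw [Distinct, Multiset.cons_add, Multiset.map_cons, Multiset.nodup_cons] at hd
    have hy := Distinct.ne_of_cons hd.2
    have hm : ∀ p ∈ Γ + Δ, (if p.1 = x ∨ p.1 = y then z else p.1) = p.1 := fun p hp =>
      if_neg (not_or.2 ⟨hx p (by rw [Multiset.cons_add]; exact Multiset.mem_cons_of_mem hp),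
        hy p hp⟩)
    have hΔ : ∀ p ∈ Δ, r (if p.1 = x ∨ p.1 = y then z else p.1) = r p.1 := fun p hp => by
      rw [hm p (Multiset.mem_add.2 (.inr hp))]
    simp only [Term.rename_subst]
    rw [← resources_congr (r := fun v => r (if v = x ∨ v = y then z else v)) hΔ]
    -- The contraction is absorbed into the valuation: `x` and `y` both receive the family of `z`,
    -- which has no resources to duplicate.
    have hσ' := (hσ.mono (fun p hp => Multiset.mem_cons_of_mem hp) fun p hp => hp).congr
      (σ' := fun v => σ (if v = x ∨ v = y then z else v))
      (r' := fun v => r (if v = x ∨ v = y then z else v))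
      (fun p hp => by rw [hm p hp]) fun p hp => (hΔ p hp).symm
    have hz := hσ.imp _ (Multiset.mem_cons_self _ _)
    refine ih ⟨?_, hσ'.lin⟩
    simp only [Multiset.forall_mem_cons]
    exact ⟨by simpa using hz, by simpa using hz, hσ'.imp⟩
  | @derel Γ Δ x t L B h ih =>
    have hx := (Distinct.cons_comm.1 h.distinct).ne_of_cons
    have hL : L.ImpFree := h.stratified.2.2 _ (Multiset.mem_cons_self _ _)
    have hσx := hσ.imp _ (Multiset.mem_cons_self _ _)
    rw [hL.erase] at hσx
    -- The family of `x` has no resources, so `r` is reset to 0 at `x` and the total is that of `Δ`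
    -- alone.
    have := ih (((hσ.mono (fun p hp => Multiset.mem_cons_of_mem hp) fun p hp => hp).update_lin
      (L := L) hx hσx))
    rw [resources_cons, resources_update hx, Function.update_self, zero_add,
      Function.update_eq_self] at this
    exact this
  | weak _ _ _ _ ih =>
    rw [resources_add]
    exact (ih (hσ.mono (fun p hp => Multiset.mem_add.2 (.inl hp))
      fun p hp => Multiset.mem_add.2 (.inl hp))).mono (Multiset.le_add_right _ _)

/-! ### Church words -/

/-- `u_{i₁} (u_{i₂} (⋯ (u_{iₙ} x) ⋯))` for `w = i₁ ⋯ iₙ`, where `x` is the index `0`. -/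
def iterWord (u₀ u₁ : Term) (w : List Bool) : Term :=
  w.foldr (fun i s => .app (if i then u₁ else u₀) s) (.var 0)

theorem churchWord_eq (w : List Bool) :
    churchWord w = .lam (.lam (.lam (iterWord (.var 2) (.var 1) w))) := by
  simp only [churchWord, iterWord, apply_ite Term.var]

theorem iterWord_subst (u₀ u₁ : Term) (w : List Bool) {σ : ℕ → Term} (hσ : σ 0 = .var 0) :
    (iterWord u₀ u₁ w).subst σ = iterWord (u₀.subst σ) (u₁.subst σ) w := by
  induction w with
  | nil => exact hσ
  | cons i w ih =>
    change Term.app _ _ = Term.app _ _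
    congr 1
    cases i <;> rfl

theorem churchWord_rename (w : List Bool) (ρ : ℕ → ℕ) :
    (churchWord w).rename ρ = churchWord w := by
  rw [churchWord_eq, Term.rename_eq_subst]
  simp only [Term.subst]
  rw [iterWord_subst] <;> rfl

theorem churchWord_app_app (w : List Bool) (u₀ u₁ : Term) :
    BetaStar (.app (.app (churchWord w) u₀) u₁)
      (.lam (iterWord (u₀.rename Nat.succ) (u₁.rename Nat.succ) w)) := by
  rw [churchWord_eq]
  have h : ((Term.lam (Term.lam (iterWord (.var 2) (.var 1) w))).inst u₀) =
      .lam (.lam (iterWord ((u₀.rename Nat.succ).rename Nat.succ) (.var 1) w)) := by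
    simp only [Term.inst, Term.subst]
    rw [iterWord_subst] <;> rfl
  have h' : ((Term.lam (iterWord ((u₀.rename Nat.succ).rename Nat.succ) (.var 1) w)).inst u₁) =
      .lam (iterWord (u₀.rename Nat.succ) (u₁.rename Nat.succ) w) := by
    simp only [Term.inst, Term.subst]
    rw [iterWord_subst _ _ _ (by rfl), Term.rename_subst, Term.rename_eq_subst u₀,
      Term.subst_subst]
    rfl
  have step := Beta.redex (.lam (.lam (iterWord (.var 2) (.var 1) w))) u₀
  have step' := Beta.redex (.lam (iterWord ((u₀.rename Nat.succ).rename Nat.succ) (.var 1) w)) u₁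
  rw [h] at step
  rw [h'] at step'
  exact .head (.appL _ step) (.single step')

theorem iterWord_betaStar {u₀ u₁ a₀ a₁ : Term} (h₀ : BetaStar u₀ a₀) (h₁ : BetaStar u₁ a₁)
    (w : List Bool) : BetaStar (iterWord u₀ u₁ w) (iterWord a₀ a₁ w) := by
  induction w with
  | nil => exact .refl
  | cons i w ih => cases i <;> exact BetaStar.app (by assumption) ih

theorem iterWord_affine {a₀ a₁ : Term} (h₀ : a₀.Affine) (h₁ : a₁.Affine) (w : List Bool) :
    (iterWord a₀ a₁ w).Affine := by
  induction w with
  | nil => trivial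
  | cons i w ih => cases i <;> exact ⟨by assumption, ih⟩

/-- Closed step terms leave only the starting point free, once, however long the word is. -/
theorem iterWord_fv {a₀ a₁ : Term} (h₀ : a₀.fv = 0) (h₁ : a₁.fv = 0) (w : List Bool) :
    (iterWord a₀ a₁ w).fv = {0} := by
  induction w with
  | nil => rfl
  | cons i w ih =>
    change Term.fv _ + (iterWord a₀ a₁ w).fv = _
    rw [ih]
    cases i <;> simp [h₀, h₁]

theorem iterWord_apps_le (a₀ a₁ : Term) (w : List Bool) :
    (iterWord a₀ a₁ w).apps ≤ w.length * (a₀.apps + a₁.apps + 1) := by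
  induction w with
  | nil => exact Nat.zero_le _
  | cons i w ih =>
    change Term.apps _ + (iterWord a₀ a₁ w).apps + 1 ≤ _
    rw [List.length_cons, Nat.add_mul]
    cases i <;> simp <;> omega

theorem reducible_iterWord {f₀ f₁ : List Bool → Term} (h₀ : AffineReducible 0 f₀)
    (h₁ : AffineReducible 0 f₁) : AffineReducible {0} fun w => iterWord (f₀ w) (f₁ w) w := by
  obtain ⟨P, hP⟩ := h₀
  obtain ⟨Q, hQ⟩ := h₁
  -- Each letter costs one application and one copy of a step term; the sum `P + Q` bounds both step
  -- terms.
  refine ⟨Polynomial.X * (P + Q + 1), fun w => ?_⟩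
  obtain ⟨a, ha1, ha2, ha3, ha4⟩ := hP w
  obtain ⟨b, hb1, hb2, hb3, hb4⟩ := hQ w
  refine ⟨iterWord a b w, iterWord_betaStar ha1 hb1 w, iterWord_affine ha2 hb2 w,
    (iterWord_fv (Multiset.le_zero.1 ha3) (Multiset.le_zero.1 hb3) w).le,
    (iterWord_apps_le a b w).trans ?_⟩
  simp only [Polynomial.eval_mul, Polynomial.eval_X, Polynomial.eval_add, Polynomial.eval_one]
  gcongr

theorem reducible_churchWord : Reducible churchW.erase 0 churchWord := by
  intro ρ g₀ h₀ τ g₁ h₁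
  simp only [Term.rename, churchWord_rename]
  refine Reducible.expand (S := .base) (Reducible.lam ?_) fun w => churchWord_app_app w _ _
  exact reducible_iterWord (Reducible.rename (S := .base) (Reducible.rename (S := .base) h₀ τ) _)
    (Reducible.rename (S := .base) h₁ _)

end DIAL

theorem theorem6 (t : DIAL.Term) (L : DIAL.Fm) (hL : L.IsLinear)
    (ht : DIAL.Typed 0 0 t (.imp DIAL.churchW L)) :
    ∃ P : Polynomial ℕ, ∀ w : List Bool,
      (∃ u, DIAL.IsBetaNF (.app t (DIAL.churchWord w)) u) ∧
      ∀ u, DIAL.IsBetaNF (.app t (DIAL.churchWord w)) u → u.apps ≤ P.eval w.length := by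
  -- Both contexts are empty, so the identity substitution without resources is a valuation.
  have h := ht.reducible (σ := fun x _ => .var x) (r := fun _ => 0) ⟨by simp, by simp⟩
  simp only [DIAL.Term.subst_var] at h
  have := h.app_imp DIAL.reducible_churchWord
  rw [hL.impFree.erase] at this
  obtain ⟨P, hP⟩ := this
  refine ⟨P, fun w => ?_⟩
  obtain ⟨a, hta, ha, -, hle⟩ := hP w
  obtain ⟨n, hn, hna⟩ := ha.exists_isBetaNF
  have hn' : DIAL.IsBetaNF (.app t (DIAL.churchWord w)) n := ⟨hta.trans hn.1, hn.2⟩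
  exact ⟨⟨n, hn'⟩, fun u hu => (hu.unique hn').symm ▸ hna.trans hle⟩
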